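/- Let $P,Q$ be coprime positive integers, $\alpha=P/Q$ and $q=e^{i\pi\alpha}$. For real $\kappa_+,\kappa_-$ put $z=e^{i(\kappa_-+\pi/2)}$ and let $\hat H'_c(\kappa_+,\kappa_-)$ be the $Q\times Q$ complex matrix which is the sum, over $k=1,\dots,Q$ and with indices read modulo $Q$, of the contributions \[ z\cdot 2\cos(k\pi\alpha+\kappa_+)\ \text{ at position } (k,k+1),\qquad z^{-1}\cdot 2\cos(k\pi\alpha+\kappa_+)\ \text{ at position } (k+1,k). \] (Equivalently, for $Q\ge 2$, $\hat H'_c=(q-q^{-1})\,(z^{-1}\zeta_c(E)+z\,\zeta_c(F))$, where the only nonzero entries of the matrices $\zeta_c(E),\zeta_c(F)$ are, with indices modulo $Q$, $\zeta_c(E)_{k+1,k}=\zeta_c(F)_{k,k+1}=\frac{e^{i\kappa_+}q^k+e^{-i\kappa_+}q^{-k}}{q-q^{-1}}$ for $k=1,\dots,Q$.) Define the sign \[ \epsilon(P,Q)=\begin{cases}(-1)^{(P-1)/2}& Q \text{ even}\\ (-1)^{(Q+1)(P+1)/2}& Q\text{ odd.}\end{cases} \] Then, for all real $\kappa_+,\kappa_-$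 and all complex $E$, \[ \det(\hat H'_c(\kappa_+,\kappa_-)-E)=\det(\hat H'_c(0,0)-E)+g(P,Q,\kappa_+,\kappa_-), \] \[ g(P,Q,\kappa_+,\kappa_-)=\begin{cases}\epsilon(P,Q)\cdot 4\cos(Q\kappa_-)\sin(Q\kappa_+)& Q\text{ even}\\ \epsilon(P,Q)\cdot 4\sin(Q\kappa_-)\cos(Q\kappa_+)& Q\text{ odd.}\end{cases} \] Moreover $(\nu'_x,\nu'_y)\mapsto(\kappa_+,\kappa_-)$, $\kappa_\pm=\tfrac12\epsilon(P,Q)\bigl((-1)^Q\nu'_x\pm\nu'_y\bigr)$, is a change of coordinates of $\mathbb R^2$ (a bijection), under which $g$ becomes the offset of the usual Chambers relation in coordinates centered at the mid-band point: \[ g(P,Q,\kappa_+,\kappa_-)=(-1)^Q\cdot 2\bigl(\sin(Q\nu'_x)+\sin(Q\nu'_y)\bigr). \] -/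

import Mathlib

noncomputable section

namespace Hofstadter

open Matrix

/-- The deformation parameter `q = exp(iπα)` for the flux `α = P/Q`. -/
def q (P Q : ℕ) : ℂ := Complex.exp (Complex.I * (Real.pi * ((P : ℂ) / (Q : ℂ))))

/-- The Chebyshev-type entry `2 cos(kπα + κ₊)` for the flux `α = P/Q`. -/
def entry (P Q : ℕ) (κp : ℝ) (k : ℕ) : ℝ :=
  2 * Real.cos ((k : ℝ) * Real.pi * ((P : ℝ) / (Q : ℝ)) + κp)

/-- The coefficient `(exp(iκ₊) q^k + exp(-iκ₊) q^(-k)) / (q - q⁻¹)`. -/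
def zetaCoeff (P Q : ℕ) (κp : ℝ) (k : ℕ) : ℂ :=
  (Complex.exp (Complex.I * κp) * q P Q ^ k + Complex.exp (-(Complex.I * κp)) * (q P Q)⁻¹ ^ k) /
    (q P Q - (q P Q)⁻¹)

/-- The matrix `ζ_c(E)`, continued periodically: its `(k+1, k)` entry is the `k`-th coefficient for
`k = 1, …, Q`, row `Q + 1` being row `1`. The index `i : Fin Q` stands for the row or column
number `i + 1`. -/
def zetaE (P Q : ℕ) (κp : ℝ) : Matrix (Fin Q) (Fin Q) ℂ :=
  Matrix.of fun i j => if ((j : ℕ) + 1) % Q = (i : ℕ) then zetaCoeff P Q κp ((j : ℕ) + 1) else 0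

/-- The matrix `ζ_c(F)`, continued periodically: its `(k, k+1)` entry is the `k`-th coefficient for
`k = 1, …, Q`, column `Q + 1` being column `1`. -/
def zetaF (P Q : ℕ) (κp : ℝ) : Matrix (Fin Q) (Fin Q) ℂ :=
  Matrix.of fun i j => if ((i : ℕ) + 1) % Q = (j : ℕ) then zetaCoeff P Q κp ((i : ℕ) + 1) else 0

/-- The phase `z = exp(i(κ₋ + π/2))`. -/
def phase (κm : ℝ) : ℂ := Complex.exp (Complex.I * ((κm : ℂ) + (Real.pi : ℂ) / 2))

/-- The Hamiltonian `Ĥ'_c(κ₊, κ₋)`: the periodic matrix with `2 cos(kπα + κ₊) z` at `(k, k+1)` and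
`2 cos(kπα + κ₊) z⁻¹` at `(k+1, k)`, for `k = 1, …, Q` (indices modulo `Q`). Contributions that
fall on the same position, which happens only for `Q ≤ 2`, are added. -/
def Hc (P Q : ℕ) (κp κm : ℝ) : Matrix (Fin Q) (Fin Q) ℂ :=
  Matrix.of fun i j =>
    (if ((i : ℕ) + 1) % Q = (j : ℕ) then phase κm * (entry P Q κp ((i : ℕ) + 1) : ℂ) else 0) +
    (if ((j : ℕ) + 1) % Q = (i : ℕ) then (phase κm)⁻¹ * (entry P Q κp ((j : ℕ) + 1) : ℂ) else 0)

/-- The sign `ε(P, Q)`. For `P`, `Q` coprime both exponents are exact quotients. -/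
def eps (P Q : ℕ) : ℝ :=
  if Even Q then (-1) ^ ((P - 1) / 2) else (-1) ^ ((Q + 1) * (P + 1) / 2)

/-- The change of coordinates `(ν'_x, ν'_y) ↦ (κ₊, κ₋)`. -/
def coords (P Q : ℕ) (ν : ℝ × ℝ) : ℝ × ℝ :=
  (1 / 2 * eps P Q * ((-1) ^ Q * ν.1 + ν.2), 1 / 2 * eps P Q * ((-1) ^ Q * ν.1 - ν.2))

/-- The offset function `g(P, Q, κ₊, κ₋)`. -/
def offset (P Q : ℕ) (κp κm : ℝ) : ℝ :=
  if Even Q then eps P Q * (4 * Real.cos (Q * κm) * Real.sin (Q * κp))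
  else eps P Q * (4 * Real.sin (Q * κm) * Real.cos (Q * κp))

theorem q_sub_inv_ne_zero {P Q : ℕ} (hQ : 2 ≤ Q) (h : Nat.Coprime P Q) :
    q P Q - (q P Q)⁻¹ ≠ 0 := by
  intro h0
  have hq : q P Q ≠ 0 := Complex.exp_ne_zero _
  have h2 : q P Q * q P Q = 1 := by
    have : q P Q = (q P Q)⁻¹ := sub_eq_zero.mp h0
    nth_rewrite 2 [this]
    exact mul_inv_cancel₀ hq
  rw [q, ← Complex.exp_add, Complex.exp_eq_one_iff] at h2
  obtain ⟨n, hn⟩ := h2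
  have hQ0 : (Q : ℂ) ≠ 0 := by exact_mod_cast (by omega : Q ≠ 0)
  have hpi : (Real.pi : ℂ) ≠ 0 := by exact_mod_cast Real.pi_ne_zero
  have h3 : (P : ℂ) = n * Q := by
    have h4 : (2 * Real.pi * Complex.I) * ((P : ℂ) / Q) = (2 * Real.pi * Complex.I) * n := by
      linear_combination hn
    have h5 := mul_left_cancel₀ (by simp [hpi]) h4
    rwa [div_eq_iff hQ0] at h5
  have h6 : (P : ℤ) = n * Q := by exact_mod_cast h3
  have h7 : Q ∣ P := by
    have : (Q : ℤ) ∣ P := ⟨n, by rw [h6]; ring⟩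
    exact_mod_cast this
  have := Nat.eq_one_of_dvd_coprimes h h7 dvd_rfl
  omega

theorem zetaCoeff_mul {P Q : ℕ} (hQ : 2 ≤ Q) (h : Nat.Coprime P Q) (κp : ℝ) (k : ℕ) :
    (q P Q - (q P Q)⁻¹) * zetaCoeff P Q κp k = (entry P Q κp k : ℂ) := by
  rw [zetaCoeff, mul_div_cancel₀ _ (q_sub_inv_ne_zero hQ h), q, ← Complex.exp_neg,
    ← Complex.exp_nat_mul, ← Complex.exp_nat_mul, ← Complex.exp_add, ← Complex.exp_add, entry]
  push_cast
  rw [Complex.two_cos]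
  congr 2 <;> ring

/-- `Ĥ'_c(κ₊, κ₋) = (q - q⁻¹) ζ_c(z⁻¹ E + z F)` whenever `q - q⁻¹` does not vanish. -/
theorem Hc_eq_zeta {P Q : ℕ} (hQ : 2 ≤ Q) (h : Nat.Coprime P Q) (κp κm : ℝ) :
    Hc P Q κp κm = (q P Q - (q P Q)⁻¹) •
      ((phase κm)⁻¹ • zetaE P Q κp + phase κm • zetaF P Q κp) := by
  ext i j
  simp only [Hc, zetaE, zetaF, Matrix.of_apply, Matrix.smul_apply, Matrix.add_apply, smul_eq_mul,
    ← zetaCoeff_mul hQ h]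
  split_ifs <;> ring

end Hofstadter

end

/-! Give the four Fourier components of the bonds and the energy independent coefficients `s 0`, …,
`s 4`; the determinant becomes a homogeneous polynomial of degree `Q`. A cyclic relabelling of the
sites with a diagonal gauge shows that it is invariant under scaling (`s 0`, `s 3`) by (`q²`, `q⁻²`)
(`harperDet_shift`); exchanging `q` and `q⁻¹` treats `s 1` and `s 2`. Since `q²` is a primitive
`Q`-th root of unity, exponents of surviving monomials satisfy `m 0 ≡ m 3` and `m 1 ≡ m 2` modulo
`Q`. The degree then leaves equality in both or a pure `Q`-th power of one hopping coefficient
(`support_harperPoly`). At the physical values `s 0 * s 3 = s 1 * s 2 = 1`, so balanced monomials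
depend on `E` alone, while the four pure powers sum to the offset (`harperDet_eq_const_add`,
`offset_eq`). The function of `E` need not be computed: the offset vanishes at the origin, so it is
the determinant there. -/

open Matrix MvPolynomial

namespace Hofstadter

/-! ### Determinants of matrices with bonds along a permutation -/

section BondMatrix

variable {ι R : Type*} [Fintype ι] [DecidableEq ι] [CommRing R]

/-- The matrix with bonds `x i` from `i` to `σ i` and `y i` back, and constant diagonal `-e`. -/
def bondMatrix (σ : Equiv.Perm ι) (x y : ι → R) (e : R) : Matrix ι ι R :=
  Matrix.of fun i j =>
    (if σ i = j then x i else 0) + (if σ j = i then y j else 0) - (if i = j then e else 0)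

/-- Relabelling by `σ` preserves the determinant, and so do the diagonal factors `g` and `h`, being
mutually inverse; for the same reason the diagonal `-e` is untouched. -/
theorem det_bondMatrix_gauge (σ : Equiv.Perm ι) (x y g h : ι → R) (e : R)
    (hgh : ∀ i, g i * h i = 1) :
    (bondMatrix σ (fun i => g i * x (σ i) * h (σ i)) (fun j => g (σ j) * y (σ j) * h j) e).det =
      (bondMatrix σ x y e).det := by
  have key : bondMatrix σ (fun i => g i * x (σ i) * h (σ i))
      (fun j => g (σ j) * y (σ j) * h j) e =
      diagonal g * (bondMatrix σ x y e).submatrix σ σ * diagonal h := by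
    ext i j
    simp only [bondMatrix, mul_diagonal, diagonal_mul, submatrix_apply, of_apply,
      EmbeddingLike.apply_eq_iff_eq]
    have hi := hgh i
    split_ifs with h1 h2 h3 h3 h2 h3 h3 <;> subst_vars <;> grind
  rw [key, det_mul, det_mul, det_submatrix_equiv_self, det_diagonal, det_diagonal]
  have : (∏ i, g i) * ∏ i, h i = 1 := by
    rw [← Finset.prod_mul_distrib]; exact Finset.prod_eq_one fun i _ => hgh i
  linear_combination (bondMatrix σ x y e).det * this

theorem det_bondMatrix_left (σ : Equiv.Perm ι) (x : ι → R) :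
    (bondMatrix σ x 0 0).det = (Equiv.Perm.sign σ : ℤ) * ∏ i, x i := by
  have key : bondMatrix σ x 0 0 = diagonal x * σ.permMatrix R := by
    ext i j
    simp [bondMatrix, diagonal_mul, Equiv.Perm.permMatrix, PEquiv.toMatrix_apply, eq_comm]
  rw [key, det_mul, det_diagonal, det_permutation, mul_comm]

theorem det_bondMatrix_right (σ : Equiv.Perm ι) (y : ι → R) :
    (bondMatrix σ 0 y 0).det = (Equiv.Perm.sign σ : ℤ) * ∏ i, y i := by
  rw [← det_bondMatrix_left, ← det_transpose]
  congr 1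
  ext i j
  simp [bondMatrix]

theorem map_det_bondMatrix {S : Type*} [CommRing S] (f : R →+* S) (σ : Equiv.Perm ι)
    (x y : ι → R) (e : R) :
    f (bondMatrix σ x y e).det =
      (bondMatrix σ (fun i => f (x i)) (fun i => f (y i)) (f e)).det := by
  rw [RingHom.map_det]
  congr 1
  ext i j
  simp only [bondMatrix, RingHom.mapMatrix_apply, map_apply, of_apply, map_add, map_sub, apply_ite f,
    map_zero]

end BondMatrix

/-! ### The Harper determinant with free coefficients and its symmetries -/

/-- The determinant of the Harper matrix with independent coefficients `s 0, …, s 3` in front of its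
four Fourier components and energy `s 4`. -/
def harperDet {R : Type*} [CommRing R] (n : ℕ) (q p : R) (s : Fin 5 → R) : R :=
  (bondMatrix (finRotate (n + 1))
    (fun i => s 0 * q ^ (i.val + 1) + s 1 * p ^ (i.val + 1))
    (fun i => s 2 * q ^ (i.val + 1) + s 3 * p ^ (i.val + 1)) (s 4)).det

theorem map_harperDet {R S : Type*} [CommRing R] [CommRing S] (f : R →+* S) (n : ℕ) (q p : R)
    (s : Fin 5 → R) :
    f (harperDet n q p s) = harperDet n (f q) (f p) (fun i => f (s i)) := by
  simp [harperDet, map_det_bondMatrix]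

theorem harperDet_swap {R : Type*} [CommRing R] (n : ℕ) (q p : R) (s : Fin 5 → R) :
    harperDet n p q s = harperDet n q p ![s 1, s 0, s 3, s 2, s 4] := by
  simp [harperDet, add_comm]

/-- Moving one site multiplies `q ^ k` by `q` and `q⁻¹ ^ k` by `q⁻¹`; the gauge `q⁻¹ ^ i` gives
forward bonds a further `q` and backward bonds `q⁻¹`. The factors cancel for `s 1` and `s 2` and
double for `s 0` and `s 3`. -/
theorem harperDet_shift {K : Type*} [Field K] (n : ℕ) {q : K} (hq : q ^ (2 * (n + 1)) = 1)
    (s : Fin 5 → K) :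
    harperDet n q q⁻¹ ![q ^ 2 * s 0, s 1, s 2, q⁻¹ ^ 2 * s 3, s 4] = harperDet n q q⁻¹ s := by
  have hq0 : q ≠ 0 := by rintro rfl; simp at hq
  unfold harperDet
  rw [← det_bondMatrix_gauge (finRotate (n + 1)) _ _ (fun i => q⁻¹ ^ i.val) (fun i => q ^ i.val)
    (s 4) (fun i => by rw [← mul_pow, inv_mul_cancel₀ hq0, one_pow])]
  have hrot (i : Fin (n + 1)) : (finRotate (n + 1) i).val = i.val + 1 ∨
      i.val = n ∧ (finRotate (n + 1) i).val = 0 := by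
    rw [coe_finRotate]
    split_ifs with h
    · exact Or.inr ⟨by simp [h], rfl⟩
    · exact Or.inl rfl
  have hqp : q * q⁻¹ = 1 := mul_inv_cancel₀ hq0
  have hpow (k : ℕ) : q ^ k * q⁻¹ ^ k = 1 := by rw [← mul_pow, hqp, one_pow]
  -- The bond closing the cycle, from site `n` to site `0`, is where `q ^ (2 * (n + 1)) = 1` is
  -- needed.
  have hn : q ^ n * q ^ 2 = q⁻¹ ^ n := by
    have : q ^ n * q ^ n * q ^ 2 = 1 := by rw [← hq]; ring
    linear_combination q⁻¹ ^ n * this - q ^ n * q ^ 2 * hpow n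
  generalize q⁻¹ = p at *
  congr 1
  congr 1
  · ext i
    have hi := hpow i
    rcases hrot i with h | ⟨h, h'⟩
    · simp only [h, Matrix.cons_val, pow_succ] at hi ⊢
      generalize q ^ i.val = A at *
      generalize p ^ i.val = B at *
      clear hrot h hpow hn hq
      grind
    · simp only [h, h', Matrix.cons_val, pow_succ] at hi hn ⊢
      generalize q ^ n = A at *
      generalize p ^ n = B at *
      clear hrot h hpow hq
      grind
  · ext i
    have hi := hpow i
    rcases hrot i with h | ⟨h, h'⟩
    · simp only [h, Matrix.cons_val, pow_succ] at hi ⊢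
      generalize q ^ i.val = A at *
      generalize p ^ i.val = B at *
      clear hrot h hpow hn hq
      grind
    · simp only [h, h', Matrix.cons_val, pow_succ] at hi hn ⊢
      generalize q ^ n = A at *
      generalize p ^ n = B at *
      clear hrot h hpow hq
      grind

/-! ### Polynomials invariant under a diagonal scaling -/

theorem coeff_aeval_C_mul_X {σ R : Type*} [CommRing R] [Fintype σ] (l : σ → R)
    (F : MvPolynomial σ R) (m : σ →₀ ℕ) :
    coeff m (aeval (fun i => C (l i) * X i) F) = (∏ i, l i ^ m i) * coeff m F := by
  classical
  induction F using MvPolynomial.induction_on' with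
  | monomial k a =>
    have : aeval (fun i => C (l i) * X i) (monomial k a) =
        monomial k ((∏ i, l i ^ k i) * a) := by
      rw [aeval_monomial, Finsupp.prod_fintype _ _ (by simp), monomial_eq,
        Finsupp.prod_fintype _ _ (by simp)]
      simp only [mul_pow, Finset.prod_mul_distrib, map_mul, map_prod, map_pow, algebraMap_eq]
      ring
    rw [this]
    simp only [coeff_monomial]
    split_ifs with h
    · rw [h]
    · simp
  | add F G hF hG => rw [map_add, coeff_add, coeff_add, hF, hG, mul_add]

/-- A polynomial function invariant under a diagonal scaling only involves invariant monomials. -/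
theorem prod_pow_eq_one_of_coeff_ne_zero {σ K : Type*} [Field K] [Infinite K] [Fintype σ]
    (l : σ → K) (F : MvPolynomial σ K)
    (hF : ∀ s : σ → K, eval (fun i => l i * s i) F = eval s F) {m : σ →₀ ℕ} (hm : coeff m F ≠ 0) :
    ∏ i, l i ^ m i = 1 := by
  have h : aeval (fun i => C (l i) * X i) F = F := by
    refine MvPolynomial.funext fun s => ?_
    rw [← hF s, ← coe_aeval_eq_eval, ← coe_aeval_eq_eval, RingHom.coe_coe, RingHom.coe_coe,
      ← AlgHom.comp_apply]
    congr 1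
    ext i
    simp [mul_comm]
  have := coeff_aeval_C_mul_X l F m
  rw [h] at this
  exact mul_right_cancel₀ hm (by rw [← this, one_mul])

/-! ### Monomials of the Harper determinant -/

/-- The polynomial whose values are given by `harperDet`. -/
noncomputable def harperPoly (n : ℕ) (q : ℂ) : MvPolynomial (Fin 5) ℂ := harperDet n (C q) (C q⁻¹) X

theorem eval_harperPoly (n : ℕ) (q : ℂ) (s : Fin 5 → ℂ) :
    eval s (harperPoly n q) = harperDet n q q⁻¹ s := by
  simp [harperPoly, map_harperDet]

theorem isHomogeneous_harperPoly (n : ℕ) (q : ℂ) : (harperPoly n q).IsHomogeneous (n + 1) := by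
  unfold harperPoly harperDet
  rw [det_apply]
  refine IsHomogeneous.sum _ _ _ fun τ _ => ?_
  have : (∏ i, bondMatrix (finRotate (n + 1))
      (fun i => (X 0 : MvPolynomial (Fin 5) ℂ) * C q ^ (i.val + 1) + X 1 * C q⁻¹ ^ (i.val + 1))
      (fun i => X 2 * C q ^ (i.val + 1) + X 3 * C q⁻¹ ^ (i.val + 1)) (X 4) (τ i) i).IsHomogeneous
      (∑ _i : Fin (n + 1), 1) := by
    refine IsHomogeneous.prod _ _ _ fun i _ => ?_
    have hX (k l : Fin 5) (a b : ℂ) (N : ℕ) :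
        ((X k : MvPolynomial (Fin 5) ℂ) * C a ^ N + X l * C b ^ N).IsHomogeneous 1 := by
      simp only [← C_pow]
      exact ((isHomogeneous_X _ _).mul (isHomogeneous_C _ _)).add
        ((isHomogeneous_X _ _).mul (isHomogeneous_C _ _))
    simp only [bondMatrix, of_apply]
    refine IsHomogeneous.sub (IsHomogeneous.add ?_ ?_) ?_ <;> split_ifs <;>
      first | exact hX _ _ _ _ _ | exact isHomogeneous_X _ _ | exact isHomogeneous_zero _ _ _
  simp only [Finset.sum_const, Finset.card_univ, Fintype.card_fin, smul_eq_mul, mul_one] at this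
  rcases Int.units_eq_one_or (Equiv.Perm.sign τ) with h | h
  · simpa [h] using this
  · simpa [h] using this.neg

theorem q_pow_modEq {q : ℂ} {N : ℕ} (hq : IsPrimitiveRoot (q ^ 2) N) {a d : ℕ}
    (hN : N ≠ 0) (h : (q ^ 2) ^ a * (q⁻¹ ^ 2) ^ d = 1) : a ≡ d [MOD N] := by
  have hq0 : q ^ 2 ≠ 0 := hq.ne_zero hN
  rw [Nat.ModEq.comm, Nat.modEq_iff_dvd, ← hq.zpow_eq_one_iff_dvd, zpow_sub₀ hq0, zpow_natCast,
    zpow_natCast, div_eq_mul_inv, ← inv_pow, ← inv_pow]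
  exact h

theorem support_harperPoly {n : ℕ} {q : ℂ} (hq : IsPrimitiveRoot (q ^ 2) (n + 1)) {m : Fin 5 →₀ ℕ}
    (hm : coeff m (harperPoly n q) ≠ 0) :
    (m 0 = m 3 ∧ m 1 = m 2) ∨ ∃ k : Fin 5, k ≠ 4 ∧ m = Finsupp.single k (n + 1) := by
  have hq1 : q ^ (2 * (n + 1)) = 1 := by rw [pow_mul]; exact hq.pow_eq_one
  have hq1' : q⁻¹ ^ (2 * (n + 1)) = 1 := by rw [inv_pow, hq1, inv_one]
  have h1 : ∏ i, (![q ^ 2, 1, 1, q⁻¹ ^ 2, 1] : Fin 5 → ℂ) i ^ m i = 1 := by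
    refine prod_pow_eq_one_of_coeff_ne_zero _ _ (fun s => ?_) hm
    rw [eval_harperPoly, eval_harperPoly, ← harperDet_shift n hq1 s]
    congr 1
    ext i
    fin_cases i <;> simp
  have h2 : ∏ i, (![1, q⁻¹ ^ 2, q ^ 2, 1, 1] : Fin 5 → ℂ) i ^ m i = 1 := by
    refine prod_pow_eq_one_of_coeff_ne_zero _ _ (fun s => ?_) hm
    -- The same shift for `q⁻¹`, with the slots swapped so that `s 1` and `s 2` are scaled.
    have h := harperDet_shift n hq1' ![s 1, s 0, s 3, s 2, s 4]
    rw [inv_inv, ← harperDet_swap n q⁻¹ q s, harperDet_swap n q q⁻¹] at h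
    rw [eval_harperPoly, eval_harperPoly, ← h]
    congr 1
    ext i
    fin_cases i <;> simp
  simp only [Fin.prod_univ_five, Matrix.cons_val, one_pow, one_mul, mul_one] at h1 h2
  have h1 := q_pow_modEq hq n.succ_ne_zero h1
  have h2 := q_pow_modEq hq n.succ_ne_zero ((mul_comm _ _).trans h2)
  have hdeg : m 0 + m 1 + m 2 + m 3 + m 4 = n + 1 := by
    have := isHomogeneous_harperPoly n q hm
    simpa [Finsupp.weight_apply, Finsupp.sum_fintype, Fin.sum_univ_five] using this
  -- Congruent exponents of sum at most `n + 1` differ only if one of them uses up the whole degree.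
  have hz (a d : ℕ) (h : a ≡ d [MOD n + 1]) (had : a + d ≤ n + 1) :
      a = d ∨ (a = n + 1 ∧ d = 0) ∨ (a = 0 ∧ d = n + 1) := by
    rcases lt_or_eq_of_le (show a ≤ n + 1 by omega) with ha | rfl
    · rcases lt_or_eq_of_le (show d ≤ n + 1 by omega) with hd | rfl
      · exact Or.inl (h.eq_of_lt_of_lt ha hd)
      · omega
    · omega
  rcases hz _ _ h1 (by omega) with h1 | h1 | h1
  · rcases hz _ _ h2 (by omega) with h2 | h2 | h2
    · exact Or.inl ⟨h1, h2.symm⟩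
    · refine Or.inr ⟨2, by decide, ?_⟩
      ext i; fin_cases i <;> simp <;> omega
    · refine Or.inr ⟨1, by decide, ?_⟩
      ext i; fin_cases i <;> simp <;> omega
  · refine Or.inr ⟨0, by decide, ?_⟩
    ext i; fin_cases i <;> simp <;> omega
  · refine Or.inr ⟨3, by decide, ?_⟩
    ext i; fin_cases i <;> simp <;> omega

/-- Every other monomial of degree `N` contains a variable that is set to zero. -/
theorem _root_.MvPolynomial.IsHomogeneous.eval_single_one {σ R : Type*} [CommSemiring R]
    [Fintype σ] [DecidableEq σ] {F : MvPolynomial σ R} {N : ℕ} (hF : F.IsHomogeneous N) (k : σ) :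
    eval (Pi.single k 1) F = coeff (Finsupp.single k N) F := by
  rw [eval_eq']
  refine (Finset.sum_eq_single (Finsupp.single k N) (fun m hm hne => ?_) fun h => ?_).trans ?_
  · obtain ⟨i, hik, hi⟩ : ∃ i, i ≠ k ∧ m i ≠ 0 := by
      by_contra! h
      have hsum : ∑ i, m i = N := by
        simpa [Finsupp.weight_apply, Finsupp.sum_fintype] using hF (mem_support_iff.mp hm)
      rw [Finset.sum_eq_single k (fun i _ hi => h i hi) (by simp)] at hsum
      refine hne (Finsupp.ext fun i => ?_)
      by_cases hi : i = k
      · rw [hi, hsum, Finsupp.single_eq_same]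
      · rw [h i hi, Finsupp.single_eq_of_ne hi]
    rw [Finset.prod_eq_zero (Finset.mem_univ i) (by simp [hik, hi]), mul_zero]
  · rw [notMem_support_iff.mp h, zero_mul]
  · rw [Finset.prod_eq_one, mul_one]
    intro i _
    by_cases hi : i = k
    · simp [hi]
    · simp [Finsupp.single_eq_of_ne hi]

theorem coeff_single_harperPoly (n : ℕ) (q : ℂ) (k : Fin 5) :
    coeff (Finsupp.single k (n + 1)) (harperPoly n q) = harperDet n q q⁻¹ (Pi.single k 1) := by
  rw [← (isHomogeneous_harperPoly n q).eval_single_one, eval_harperPoly]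

/-- With a single hopping coefficient the bonds run one way round, so only the full cycle, of sign
`(-1) ^ n`, contributes. -/
theorem harperDet_single {R : Type*} [CommRing R] (n : ℕ) (q p : R) :
    harperDet n q p (Pi.single 0 1) = (-1) ^ n * ∏ i : Fin (n + 1), q ^ (i.val + 1) ∧
    harperDet n q p (Pi.single 1 1) = (-1) ^ n * ∏ i : Fin (n + 1), p ^ (i.val + 1) ∧
    harperDet n q p (Pi.single 2 1) = (-1) ^ n * ∏ i : Fin (n + 1), q ^ (i.val + 1) ∧
    harperDet n q p (Pi.single 3 1) = (-1) ^ n * ∏ i : Fin (n + 1), p ^ (i.val + 1) := by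
  have hl (x : Fin (n + 1) → R) : (bondMatrix (finRotate (n + 1)) x (fun _ => 0) 0).det =
      (-1) ^ n * ∏ i, x i := by
    refine (det_bondMatrix_left _ _).trans ?_
    simp [sign_finRotate]
  have hr (x : Fin (n + 1) → R) : (bondMatrix (finRotate (n + 1)) (fun _ => 0) x 0).det =
      (-1) ^ n * ∏ i, x i := by
    refine (det_bondMatrix_right _ _).trans ?_
    simp [sign_finRotate]
  refine ⟨?_, ?_, ?_, ?_⟩ <;> simp [harperDet, hl, hr]

/-- The part of the determinant that does not depend on the quasi-momenta. -/
noncomputable def harperConst (n : ℕ) (q e : ℂ) : ℂ :=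
  ∑ m ∈ (harperPoly n q).support with m 0 = m 3 ∧ m 1 = m 2, coeff m (harperPoly n q) * e ^ m 4

theorem harperDet_eq_const_add {n : ℕ} {q : ℂ} (hq : IsPrimitiveRoot (q ^ 2) (n + 1)) {u v : ℂ}
    (hu : u ≠ 0) (hv : v ≠ 0) (e : ℂ) :
    harperDet n q q⁻¹ ![u, v, v⁻¹, u⁻¹, e] = harperConst n q e + (-1) ^ n *
      ((∏ i : Fin (n + 1), q ^ (i.val + 1)) * (u ^ (n + 1) + v⁻¹ ^ (n + 1)) +
        (∏ i : Fin (n + 1), q⁻¹ ^ (i.val + 1)) * (v ^ (n + 1) + u⁻¹ ^ (n + 1))) := by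
  rw [← eval_harperPoly, eval_eq',
    ← Finset.sum_filter_add_sum_filter_not _ fun m => m 0 = m 3 ∧ m 1 = m 2]
  congr 1
  · refine Finset.sum_congr rfl fun m hm => ?_
    obtain ⟨-, h1, h2⟩ := Finset.mem_filter.mp hm
    have h3 : u ^ m 3 * u⁻¹ ^ m 3 = 1 := by rw [← mul_pow, mul_inv_cancel₀ hu, one_pow]
    have h4 : v ^ m 2 * v⁻¹ ^ m 2 = 1 := by rw [← mul_pow, mul_inv_cancel₀ hv, one_pow]
    simp only [Fin.prod_univ_five, Matrix.cons_val, h1, h2]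
    linear_combination coeff m (harperPoly n q) * e ^ m 4 * (v ^ m 2 * v⁻¹ ^ m 2 * h3 + h4)
  · have hinj : Function.Injective fun k : Fin 5 => Finsupp.single k (n + 1) :=
      Finsupp.single_left_injective n.succ_ne_zero
    -- The sum may run over all four pure powers: any outside the support has coefficient zero.
    rw [Finset.sum_subset (s₂ := ({0, 1, 2, 3} : Finset (Fin 5)).image
      fun k => Finsupp.single k (n + 1)), Finset.sum_image fun a _ b _ h => hinj h]
    · obtain ⟨h0, h1, h2, h3⟩ := harperDet_single n q q⁻¹
      simp only [coeff_single_harperPoly]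
      rw [Finset.sum_insert (by decide), Finset.sum_insert (by decide),
        Finset.sum_insert (by decide), Finset.sum_singleton, h0, h1, h2, h3]
      simp [Fin.prod_univ_five]
      ring
    · intro m hm
      obtain ⟨hm, hne⟩ := Finset.mem_filter.mp hm
      obtain ⟨k, hk, rfl⟩ := (support_harperPoly hq (mem_support_iff.mp hm)).resolve_left hne
      refine Finset.mem_image_of_mem _ ?_
      fin_cases k <;> simp at hk ⊢
    · intro m hm hm'
      obtain ⟨k, hk, rfl⟩ := Finset.mem_image.mp hm
      suffices coeff (Finsupp.single k (n + 1)) (harperPoly n q) = 0 by rw [this, zero_mul]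
      by_contra hc
      refine hm' (Finset.mem_filter.mpr ⟨mem_support_iff.mpr hc, ?_⟩)
      fin_cases k <;> simp at hk ⊢

/-! ### Specialisation to the Hofstadter Hamiltonian -/

theorem isPrimitiveRoot_q_sq {P Q : ℕ} (hQ : Q ≠ 0) (h : Nat.Coprime P Q) :
    IsPrimitiveRoot (q P Q ^ 2) Q := by
  convert Complex.isPrimitiveRoot_exp_of_coprime P Q hQ h using 1
  rw [q, ← Complex.exp_nat_mul]
  congr 1
  push_cast
  ring

theorem entry_eq (P Q : ℕ) (κp : ℝ) (k : ℕ) :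
    (entry P Q κp k : ℂ) = Complex.exp (Complex.I * κp) * q P Q ^ k +
      (Complex.exp (Complex.I * κp))⁻¹ * (q P Q)⁻¹ ^ k := by
  rw [q, ← Complex.exp_neg, ← Complex.exp_neg, ← Complex.exp_nat_mul, ← Complex.exp_nat_mul,
    ← Complex.exp_add, ← Complex.exp_add, entry]
  push_cast
  rw [Complex.two_cos]
  congr 2 <;> ring

theorem det_Hc_sub (P n : ℕ) (κp κm : ℝ) (E : ℂ) :
    (Hc P (n + 1) κp κm - E • (1 : Matrix (Fin (n + 1)) (Fin (n + 1)) ℂ)).det =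
      harperDet n (q P (n + 1)) (q P (n + 1))⁻¹
        ![phase κm * Complex.exp (Complex.I * κp), phase κm * (Complex.exp (Complex.I * κp))⁻¹,
          (phase κm * (Complex.exp (Complex.I * κp))⁻¹)⁻¹,
          (phase κm * Complex.exp (Complex.I * κp))⁻¹, E] := by
  have hrot (i j : Fin (n + 1)) : finRotate (n + 1) i = j ↔ (i.val + 1) % (n + 1) = j.val := by
    rw [finRotate_apply, Fin.ext_iff, Fin.val_add, Fin.val_one', Nat.add_mod_mod]
  unfold harperDet
  congr 1
  ext i j
  simp only [Hc, bondMatrix, of_apply, Matrix.sub_apply, Matrix.smul_apply, one_apply,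
    hrot, entry_eq,
    Matrix.cons_val, mul_inv, inv_inv, smul_eq_mul, mul_ite, mul_one, mul_zero]
  congr 3 <;> ring

theorem prod_q_pow (P n : ℕ) :
    ∏ i : Fin (n + 1), q P (n + 1) ^ (i.val + 1) =
      Complex.exp (Complex.I * (Real.pi * P * (n + 2) / 2)) := by
  have hsum : (∑ i ∈ Finset.range (n + 1), (i + 1)) * 2 = (n + 1) * (n + 2) := by
    rw [Finset.sum_add_distrib, add_mul, Finset.sum_range_id_mul_two]
    simp only [Finset.sum_const, Finset.card_range, smul_eq_mul, Nat.add_sub_cancel]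
    ring
  have hsum' : ((∑ i ∈ Finset.range (n + 1), (i + 1) : ℕ) : ℂ) * 2 = (n + 1) * (n + 2) := by
    exact_mod_cast hsum
  have hn : (n + 1 : ℂ) ≠ 0 := by exact_mod_cast n.succ_ne_zero
  rw [Fin.prod_univ_eq_prod_range (fun i => q P (n + 1) ^ (i + 1)), Finset.prod_pow_eq_pow_sum, q,
    ← Complex.exp_nat_mul]
  congr 1
  push_cast at hsum' ⊢
  field_simp
  linear_combination (P : ℂ) * hsum'

/-- The trigonometric form of the part of the determinant that depends on the quasi-momenta. -/
theorem offset_eq {P n : ℕ} (h : Nat.Coprime P (n + 1)) (κp κm : ℝ) :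
    offset P (n + 1) κp κm = (-1) ^ n * (2 * Real.cos ((n + 1) * (κm + Real.pi / 2))) *
      (2 * Real.cos (Real.pi * P * (n + 2) / 2 + (n + 1) * κp)) := by
  have hshift (k : ℕ) (x : ℝ) : Real.cos (x + k * Real.pi) = (-1) ^ k * Real.cos x :=
    Real.cos_add_nat_mul_pi x k
  rcases Nat.even_or_odd' n with ⟨m, rfl | rfl⟩
  · have hodd : ¬ Even (2 * m + 1) := by simp
    have hexp : (2 * m + 1 + 1) * (P + 1) / 2 = (m + 1) * (P + 1) := by
      rw [show (2 * m + 1 + 1) * (P + 1) = 2 * ((m + 1) * (P + 1)) by ring]; simp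
    rw [offset, eps, if_neg hodd, if_neg hodd, hexp]
    push_cast
    rw [show (2 * (m : ℝ) + 1) * (κm + Real.pi / 2) = (2 * m + 1) * κm + Real.pi / 2 + m * Real.pi
      by ring, hshift, Real.cos_add_pi_div_two,
      show Real.pi * P * (2 * (m : ℝ) + 2) / 2 + (2 * m + 1) * κp =
        (2 * m + 1) * κp + (P * (m + 1) : ℕ) * Real.pi by push_cast; ring, hshift,
      Even.neg_one_pow (n := 2 * m) (by simp)]
    ring
  · have heven : Even (2 * m + 1 + 1) := ⟨m + 1, by ring⟩
    -- For even `Q`, coprimality makes `P` odd, so `π P (n + 2) / 2` is an odd multiple of `π / 2`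
    -- and the cosine in `κ₊` becomes a sine.
    obtain ⟨p, rfl⟩ : Odd P := by
      rw [← Nat.not_even_iff_odd]
      intro hP
      have := Nat.dvd_gcd hP.two_dvd heven.two_dvd
      rw [h] at this
      omega
    have hexp : (2 * p + 1 - 1) / 2 = p := by omega
    rw [offset, eps, if_pos heven, if_pos heven, hexp]
    push_cast
    rw [show (2 * (m : ℝ) + 1 + 1) * (κm + Real.pi / 2) =
        (2 * m + 1 + 1) * κm + (m + 1 : ℕ) * Real.pi by push_cast; ring, hshift,
      show Real.pi * (2 * (p : ℝ) + 1) * (2 * m + 1 + 2) / 2 + (2 * m + 1 + 1) * κp =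
        (2 * m + 1 + 1) * κp + Real.pi / 2 + (2 * p * m + 3 * p + m + 1 : ℕ) * Real.pi by
          push_cast; ring, hshift, Real.cos_add_pi_div_two,
      Odd.neg_one_pow (n := 2 * m + 1) (by simp)]
    have h1 : (-1 : ℝ) ^ (2 * p * m + 3 * p + m + 1) * (-1) ^ (m + 1) = (-1) ^ p := by
      rw [← pow_add, show 2 * p * m + 3 * p + m + 1 + (m + 1) = p + 2 * (p * m + p + m + 1) by ring,
        pow_add, Even.neg_one_pow (n := 2 * _) (by simp), mul_one]
    rw [← h1]
    ring

theorem det_Hc_eq_const_add {P n : ℕ} (h : Nat.Coprime P (n + 1)) (κp κm : ℝ) (E : ℂ) :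
    (Hc P (n + 1) κp κm - E • (1 : Matrix (Fin (n + 1)) (Fin (n + 1)) ℂ)).det =
      harperConst n (q P (n + 1)) E + (offset P (n + 1) κp κm : ℂ) := by
  have hz : phase κm ≠ 0 := Complex.exp_ne_zero _
  have hw : Complex.exp (Complex.I * κp) ≠ 0 := Complex.exp_ne_zero _
  rw [det_Hc_sub, harperDet_eq_const_add (isPrimitiveRoot_q_sq n.succ_ne_zero h)
    (mul_ne_zero hz hw) (mul_ne_zero hz (inv_ne_zero hw)), offset_eq h]
  congr 1
  have hprod : ∏ i : Fin (n + 1), (q P (n + 1))⁻¹ ^ (i.val + 1) =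
      Complex.exp (-(Complex.I * (Real.pi * P * (n + 2) / 2))) := by
    simp only [inv_pow, Finset.prod_inv_distrib, prod_q_pow, Complex.exp_neg]
  have h1 : phase κm ^ (n + 1) + (phase κm)⁻¹ ^ (n + 1) =
      2 * Complex.cos ((n + 1) * (κm + Real.pi / 2)) := by
    rw [phase, ← Complex.exp_neg, ← Complex.exp_nat_mul, ← Complex.exp_nat_mul, Complex.two_cos]
    push_cast
    congr 2 <;> ring
  have h2 : Complex.exp (Complex.I * (Real.pi * P * (n + 2) / 2)) *
        Complex.exp (Complex.I * κp) ^ (n + 1) +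
      Complex.exp (-(Complex.I * (Real.pi * P * (n + 2) / 2))) *
        (Complex.exp (Complex.I * κp))⁻¹ ^ (n + 1) =
      2 * Complex.cos (Real.pi * P * (n + 2) / 2 + (n + 1) * κp) := by
    rw [← Complex.exp_neg (Complex.I * κp), ← Complex.exp_nat_mul, ← Complex.exp_nat_mul,
      ← Complex.exp_add, ← Complex.exp_add, Complex.two_cos]
    push_cast
    congr 2 <;> ring
  rw [prod_q_pow, hprod]
  push_cast
  rw [← h1, ← h2]
  simp only [mul_inv, inv_inv, mul_pow]
  ring

/-! ### The offset in mid-band coordinates -/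

theorem offset_zero_zero (P Q : ℕ) : offset P Q 0 0 = 0 := by
  simp [offset]

theorem eps_eq_one_or (P Q : ℕ) : eps P Q = 1 ∨ eps P Q = -1 := by
  unfold eps
  split_ifs <;> exact neg_one_pow_eq_or ℝ _

theorem coords_bijective (P Q : ℕ) : Function.Bijective (coords P Q) := by
  have he : eps P Q * eps P Q = 1 := by rcases eps_eq_one_or P Q with h | h <;> simp [h]
  have hs : ((-1 : ℝ) ^ Q) * (-1) ^ Q = 1 := by rw [← mul_pow]; simp
  refine Function.bijective_iff_has_inverse.mpr
    ⟨fun κ => ((-1) ^ Q * eps P Q * (κ.1 + κ.2), eps P Q * (κ.1 - κ.2)), fun ν => ?_, fun κ => ?_⟩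
  · ext <;> simp only [coords] <;> grind
  · ext <;> simp only [coords] <;> grind

/-- Product-to-sum: `κ₊ + κ₋` and `κ₊ - κ₋` are `ε (-1) ^ Q ν'_x` and `ε ν'_y`. Sine is odd and `ε²
= 1`, so the sign `ε` cancels. -/
theorem offset_coords (P Q : ℕ) (ν : ℝ × ℝ) :
    offset P Q (coords P Q ν).1 (coords P Q ν).2 =
      (-1) ^ Q * 2 * (Real.sin (Q * ν.1) + Real.sin (Q * ν.2)) := by
  have key (a b : ℝ) : 2 * (Real.cos b * Real.sin a) = Real.sin (a + b) + Real.sin (a - b) := by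
    rw [Real.sin_add, Real.sin_sub]; ring
  by_cases hQ : Even Q
  · have h (s : ℝ) := key (Q * (1 / 2 * s * (ν.1 + ν.2))) (Q * (1 / 2 * s * (ν.1 - ν.2)))
    ring_nf at h
    rcases eps_eq_one_or P Q with he | he <;>
      simp only [offset, coords, if_pos hQ, he, hQ.neg_one_pow]
    · have := h 1
      ring_nf at this ⊢
      linarith
    · have := h (-1)
      ring_nf at this ⊢
      simp only [Real.sin_neg] at this
      linarith
  · have h (s : ℝ) := key (Q * (1 / 2 * s * (-ν.1 - ν.2))) (Q * (1 / 2 * s * (-ν.1 + ν.2)))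
    ring_nf at h
    rcases eps_eq_one_or P Q with he | he <;>
      simp only [offset, coords, if_neg hQ, he, (Nat.not_even_iff_odd.mp hQ).neg_one_pow]
    · have := h 1
      ring_nf at this ⊢
      simp only [Real.sin_neg] at this
      linarith
    · have := h (-1)
      ring_nf at this ⊢
      linarith

end Hofstadter

theorem theorem4 (P Q : ℕ) (hQ : 0 < Q) (hPQ : Nat.Coprime P Q) :
    -- the map from the old coordinates to the new ones is a change of coordinates
    Function.Bijective (Hofstadter.coords P Q) ∧
    -- the Chambers relation for the Hamiltonian in the new coordinates
    (∀ (κp κm : ℝ) (E : ℂ),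
      (Hofstadter.Hc P Q κp κm - E • (1 : Matrix (Fin Q) (Fin Q) ℂ)).det =
        (Hofstadter.Hc P Q 0 0 - E • (1 : Matrix (Fin Q) (Fin Q) ℂ)).det +
          (Hofstadter.offset P Q κp κm : ℂ)) ∧
    -- in the old coordinates the offset is that of the usual Chambers relation
    (∀ ν : ℝ × ℝ,
      Hofstadter.offset P Q (Hofstadter.coords P Q ν).1 (Hofstadter.coords P Q ν).2 =
        (-1) ^ Q * 2 * (Real.sin (Q * ν.1) + Real.sin (Q * ν.2))) := by
  refine ⟨Hofstadter.coords_bijective P Q, fun κp κm E => ?_, Hofstadter.offset_coords P Q⟩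
  obtain ⟨n, rfl⟩ := Nat.exists_eq_succ_of_ne_zero hQ.ne'
  rw [Hofstadter.det_Hc_eq_const_add hPQ, Hofstadter.det_Hc_eq_const_add hPQ 0 0,
    Hofstadter.offset_zero_zero, Complex.ofReal_zero, add_zero]
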